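/- There exist absolute constants $c, C > 0$ and $d_0 \in \mathbb{N}$ such that the following holds. Let $n, d \ge 1$ be integers with $d_0 \le d \le c\log n$ and $d\le n$, such that $N := n-d+1$ is even, let $\varepsilon\in(0,1]$, and put $D := 2^{d-1}$ and $\delta := \varepsilon/\sqrt{n}$. Let $\mathcal{D}_{n,d,\delta}$ be the law of the random distribution $P=P_{\lambda,\mu}$ on $\{0,1\}^n$ obtained as follows. Choose a perfect matching $\lambda$ of $[N]$ (a set of $N/2$ disjoint pairs $\lambda_1,\dots,\lambda_{N/2}$) uniformly at random; given $\lambda$, draw $\mu_1,\dots,\mu_D$ independently and uniformly from $\{0,1\}^{N/2}$. For $\ell\in[D]$, let $p_\ell$ be the distribution on $\{0,1\}^N$ under which the $N/2$ pairs of variables matched by $\lambda$ are mutually independent and, if $\lambda_k=\{i,j\}$, the bits $X_i, X_j$ are uniform with $\operatorname{Cov}(X_i,X_j)=(-1)^{\mu_{\ell,k}}\,\delta$. Finally, with $\iota:\{0,1\}^{d-1}\to[D]$ the bijection given by binary representation, $$P_{\lambda,\mu}(x)=\frac1D\sum_{\ell=1}^D p_\ell(x_d,\dots,x_n)\,\mathbf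 1[\iota(x_1,\dots,x_{d-1})=\ell].$$ Let $m \ge 0$ be an integer and suppose that a (possibly randomized) algorithm that takes $m$ samples from $\{0,1\}^n$ and answers ``uniform'' or ``mixture'' distinguishes the two cases with probability at least $2/3$, that is: - given $m$ i.i.d. samples from the uniform distribution $U$ on $\{0,1\}^n$, it answers ``uniform'' with probability at least $2/3$; and - given $m$ i.i.d. samples from $P$, where $P\sim\mathcal{D}_{n,d,\delta}$ is drawn once, it answers ``mixture'' with probability at least $2/3$ (over the draw of $P$, the samples and the algorithm's randomness). Then $$m \ \ge\ C\cdot\frac{2^{d/2}\,n}{\varepsilon^2}.$$ -/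

import Mathlib

open scoped BigOperators

namespace MixtureOfTrees

noncomputable section

/-- The Boolean cube `{0,1}^n`. -/
abbrev Cube (n : ℕ) : Type := Fin n → Fin 2

/-- A perfect matching of `[N]`: a set of two-element subsets ("pairs") such that every point lies
in exactly one of them. -/
def PerfectMatching (N : ℕ) : Type :=
  {M : Finset (Finset (Fin N)) // (∀ e ∈ M, e.card = 2) ∧ ∀ i : Fin N, ∃! e, e ∈ M ∧ i ∈ e}

instance (N : ℕ) : Fintype (PerfectMatching N) := by
  classical
  unfold PerfectMatching
  infer_instance

/-- The pairs of a matching, as a type. -/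
abbrev PerfectMatching.Pairs {N : ℕ} (M : PerfectMatching N) : Type := {e // e ∈ M.1}

/-- For a pair `e = {i, j}`, the joint probability mass function, evaluated at `(x i, x j)`, of two
uniform bits with covariance `γ`: this is `1/4 + γ` if `x i = x j`, and `1/4 - γ` otherwise. -/
def pairPmf {N : ℕ} (γ : ℝ) (e : Finset (Fin N)) (x : Cube N) : ℝ :=
  1 / 4 + γ * ∏ i ∈ e, (-1 : ℝ) ^ (x i : ℕ)

/-- The tree component with structure `M`: the bits of each pair `k` of `M` are uniform and have
covariance `(-1)^(μ k) * δ`, and different pairs are independent. -/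
def treePmf {N : ℕ} (M : PerfectMatching N) (μ : M.Pairs → Fin 2) (δ : ℝ) (x : Cube N) : ℝ :=
  ∏ k : M.Pairs, pairPmf ((-1 : ℝ) ^ (μ k : ℕ) * δ) k.1 x

/-- The first `d - 1` coordinates of `x`. -/
def pointerBits {n d : ℕ} (hd : 1 ≤ d) (hdn : d ≤ n) (x : Cube n) : Cube (d - 1) :=
  fun i => x ⟨i, by omega⟩

/-- The last `N = n - d + 1` coordinates of `x`. -/
def childBits {n d : ℕ} (hd : 1 ≤ d) (hdn : d ≤ n) (x : Cube n) : Cube (n - d + 1) :=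
  fun i => x ⟨d - 1 + i, by omega⟩

/-- The probability mass function `P_{M,μ}` on `{0,1}^n`. The bijection `finFunctionFinEquiv`
sends a binary string of length `d - 1` to the number it represents. -/
def mixturePmf {n d : ℕ} (hd : 1 ≤ d) (hdn : d ≤ n) (M : PerfectMatching (n - d + 1))
    (μ : Fin (2 ^ (d - 1)) → M.Pairs → Fin 2) (δ : ℝ) (x : Cube n) : ℝ :=
  (1 / (2 : ℝ) ^ (d - 1)) * ∑ l : Fin (2 ^ (d - 1)),
    treePmf M (μ l) δ (childBits hd hdn x) *
      (if finFunctionFinEquiv (pointerBits hd hdn x) = l then 1 else 0)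

/-- The uniform probability mass function on `{0,1}^n`. -/
def uniformPmf (n : ℕ) (_x : Cube n) : ℝ := 1 / 2 ^ n

/-- A (possibly randomized) `m`-sample algorithm with a binary answer: the value at a tuple of
samples is the probability of answering "uniform"; otherwise it answers "mixture". -/
abbrev Test (n m : ℕ) : Type := (Fin m → Cube n) → unitInterval

/-- The probability that `T` answers "uniform" on `m` i.i.d. samples from `P`. -/
def probUniform {n m : ℕ} (T : Test n m) (P : Cube n → ℝ) : ℝ :=
  ∑ x : Fin m → Cube n, (∏ s, P (x s)) * (T x : ℝ)

/-- The probability that `T` answers "mixture" on `m` i.i.d. samples from `P`. -/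
def probMixture {n m : ℕ} (T : Test n m) (P : Cube n → ℝ) : ℝ :=
  ∑ x : Fin m → Cube n, (∏ s, P (x s)) * (1 - (T x : ℝ))

/-- `T` distinguishes, with probability at least `2/3` in either case, the uniform distribution from
a random mixture of trees `P`. Here `P` is drawn by choosing a uniformly random perfect matching
and then independent uniformly random signs; it is drawn once, and the `m` samples are then drawn
independently from `P`. -/
def Distinguishes {n d m : ℕ} (hd : 1 ≤ d) (hdn : d ≤ n) (δ : ℝ) (T : Test n m) : Prop :=
  2 / 3 ≤ probUniform T (uniformPmf n) ∧
  2 / 3 ≤ 𝔼 M : PerfectMatching (n - d + 1), 𝔼 μ : Fin (2 ^ (d - 1)) → M.Pairs → Fin 2,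
    probMixture T (mixturePmf hd hdn M μ δ)

end

end MixtureOfTrees

open Finset

namespace MixtureOfTrees

/-! The proof is a second-moment argument. By Cauchy–Schwarz, a successful test forces the averaged
likelihood ratio of the `m` samples to have second moment at least 4/3
(`four_thirds_le_second_moment`). That moment is the average, over two independent mixtures `P`,
`Q`, of `(2^n ∑ P Q) ^ m`, and it is at most 5/4 when `m` is small (`expect_correlation_pow_le`).

The correlation `2^n ∑ P Q` is the mean over the `D` pointers of tree correlations. Since `z ^ m ≤
exp (m (z - 1))`, and signs at different pointers are independent, the average over signs factors
into `D` exponential moments with parameter `m / D`. In Fourier terms, a tree correlation is a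
multi-affine function of the signs with constant term 1. Subtracting 1 removes the term linear in `m
/ D`, so a sub-Gaussian bound leaves an exponent of order `D (m / D)² = m² / D`, whence the factor
`2^(d/2)`.

Put `a = (4δ)² = 16ε²/n`. A pair common to both matchings contributes order `a²` to the variance
proxy, and any other pair only order `a⁴`, which is negligible in total. The number of common pairs
has a bounded exponential moment (`expect_one_add_pow_card_inter_le`). So the second moment is near
1 while `m² a² / D` is small, that is, for `m` below a constant times `2^(d/2) n / ε²`. -/

/-! ### Exponential moments over random signs -/

theorem neg_one_pow_fin_two_add_one (a : Fin 2) :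
    (-1 : ℝ) ^ ((a + 1 : Fin 2) : ℕ) = -(-1 : ℝ) ^ (a : ℕ) := by
  fin_cases a <;> simp

theorem abs_prod_neg_one_pow {ι : Type*} (S : Finset ι) (μ : ι → Fin 2) :
    |∏ e ∈ S, (-1 : ℝ) ^ (μ e : ℕ)| = 1 := by
  simp [abs_prod]

/-- A sub-Gaussian bound for multi-affine functions of independent uniform signs. -/
theorem expect_exp_multiaffine_le {ι : Type*} [Fintype ι] [DecidableEq ι] (c : Finset ι → ℝ)
    (b : ι → ℝ) (hb : ∀ e, ∑ S with e ∈ S, |c S| ≤ b e) (t : ℝ) (s : Finset ι) :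
    𝔼 μ : ι → Fin 2, Real.exp (t * ∑ S ∈ s.powerset, c S * ∏ e ∈ S, (-1 : ℝ) ^ (μ e : ℕ)) ≤
      Real.exp (t * c ∅ + t ^ 2 / 2 * ∑ e ∈ s, b e ^ 2) := by
  induction s using Finset.induction_on with
  | empty => simp
  | insert e s he ih =>
    -- The sum is affine in the sign of `e`: neither `g` nor `h` depends on that sign, and `|h| ≤ b
    -- e`.
    set g : (ι → Fin 2) → ℝ := fun μ => ∑ S ∈ s.powerset, c S * ∏ k ∈ S, (-1 : ℝ) ^ (μ k : ℕ)
      with hg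
    set h : (ι → Fin 2) → ℝ :=
      fun μ => ∑ S ∈ s.powerset, c (insert e S) * ∏ k ∈ S, (-1 : ℝ) ^ (μ k : ℕ) with hh
    have hnot : ∀ S ∈ s.powerset, e ∉ S := fun S hS hc => he (mem_powerset.1 hS hc)
    have hsplit : ∀ μ : ι → Fin 2,
        ∑ S ∈ (insert e s).powerset, c S * ∏ k ∈ S, (-1 : ℝ) ^ (μ k : ℕ) =
          g μ + (-1 : ℝ) ^ (μ e : ℕ) * h μ := by
      intro μ
      rw [sum_powerset_insert he, hg, hh, mul_sum]
      congr 1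
      refine sum_congr rfl fun S hS => ?_
      rw [prod_insert (hnot S hS)]
      ring
    have hflip : ∀ (F : Finset ι → ℝ) (μ : ι → Fin 2),
        ∑ S ∈ s.powerset, F S * ∏ k ∈ S, (-1 : ℝ) ^ ((μ + Pi.single e 1 : ι → Fin 2) k : ℕ) =
          ∑ S ∈ s.powerset, F S * ∏ k ∈ S, (-1 : ℝ) ^ (μ k : ℕ) := by
      intro F μ
      refine sum_congr rfl fun S hS => ?_
      congr 1
      refine prod_congr rfl fun k hk => ?_
      have : k ≠ e := fun hke => hnot S hS (hke ▸ hk)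
      simp [this]
    have hhb : ∀ μ, |h μ| ≤ b e := by
      intro μ
      calc |h μ| ≤ ∑ S ∈ s.powerset, |c (insert e S)| := by
            refine (abs_sum_le_sum_abs _ _).trans (sum_le_sum fun S _ => ?_)
            rw [abs_mul, abs_prod_neg_one_pow, mul_one]
        _ = ∑ S ∈ s.powerset.image (insert e), |c S| := by
            rw [sum_image]
            intro S hS S' hS' heq
            rw [← erase_insert (hnot S hS), ← erase_insert (hnot S' hS')]
            exact congrArg (fun A => A.erase e) heq
        _ ≤ ∑ S with e ∈ S, |c S| := by
            refine sum_le_sum_of_subset_of_nonneg ?_ fun _ _ _ => abs_nonneg _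
            intro S hS
            obtain ⟨S', _, rfl⟩ := mem_image.1 hS
            simp
        _ ≤ b e := hb e
    -- Adding 1 at `e` preserves the uniform law and flips that sign; averaging both versions
    -- produces a `cosh`, bounded by `exp (y² / 2)`.
    have hsym : 𝔼 μ : ι → Fin 2, Real.exp (t * (g μ + (-1 : ℝ) ^ (μ e : ℕ) * h μ)) =
        𝔼 μ : ι → Fin 2, Real.exp (t * (g μ - (-1 : ℝ) ^ (μ e : ℕ) * h μ)) := by
      refine Fintype.expect_equiv (Equiv.addRight (Pi.single e 1)) _ _ fun μ => ?_
      have h1 : g (μ + Pi.single e 1) = g μ := hflip _ μ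
      have h2 : h (μ + Pi.single e 1) = h μ := hflip _ μ
      simp only [Equiv.coe_addRight, h1, h2, Pi.add_apply, Pi.single_eq_same,
        neg_one_pow_fin_two_add_one]
      ring_nf
    have hpt : ∀ μ : ι → Fin 2, (Real.exp (t * (g μ + (-1 : ℝ) ^ (μ e : ℕ) * h μ)) +
        Real.exp (t * (g μ - (-1 : ℝ) ^ (μ e : ℕ) * h μ))) / 2 ≤
          Real.exp (t ^ 2 / 2 * b e ^ 2) * Real.exp (t * g μ) := by
      intro μ
      set y := t * ((-1 : ℝ) ^ (μ e : ℕ) * h μ) with hy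
      have h1 : (Real.exp (t * (g μ + (-1 : ℝ) ^ (μ e : ℕ) * h μ)) +
          Real.exp (t * (g μ - (-1 : ℝ) ^ (μ e : ℕ) * h μ))) / 2 =
            Real.cosh y * Real.exp (t * g μ) := by
        rw [Real.cosh_eq, mul_add, mul_sub, Real.exp_add, sub_eq_add_neg, Real.exp_add]
        ring
      rw [h1]
      refine mul_le_mul_of_nonneg_right ((Real.cosh_le_exp_half_sq y).trans ?_) (Real.exp_nonneg _)
      refine Real.exp_le_exp.2 ?_
      have h2 : y ^ 2 = t ^ 2 * h μ ^ 2 := by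
        rw [hy, mul_pow, mul_pow, ← pow_mul, mul_comm (μ e : ℕ) 2, pow_mul]
        simp
      have h3 : h μ ^ 2 ≤ b e ^ 2 := by
        rw [← sq_abs (h μ)]
        exact pow_le_pow_left₀ (abs_nonneg _) (hhb μ) 2
      rw [h2]
      nlinarith [sq_nonneg t]
    calc _ = 𝔼 μ : ι → Fin 2, Real.exp (t * (g μ + (-1 : ℝ) ^ (μ e : ℕ) * h μ)) :=
          expect_congr rfl fun μ _ => by rw [hsplit μ]
      _ = 𝔼 μ : ι → Fin 2, (Real.exp (t * (g μ + (-1 : ℝ) ^ (μ e : ℕ) * h μ)) +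
            Real.exp (t * (g μ - (-1 : ℝ) ^ (μ e : ℕ) * h μ))) / 2 := by
          rw [← expect_div, expect_add_distrib, ← hsym]
          ring
      _ ≤ 𝔼 μ : ι → Fin 2, Real.exp (t ^ 2 / 2 * b e ^ 2) * Real.exp (t * g μ) :=
          expect_le_expect fun μ _ => hpt μ
      _ ≤ Real.exp (t ^ 2 / 2 * b e ^ 2) * Real.exp (t * c ∅ + t ^ 2 / 2 * ∑ e ∈ s, b e ^ 2) := by
          rw [← mul_expect]
          exact mul_le_mul_of_nonneg_left ih (Real.exp_nonneg _)
      _ = _ := by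
          rw [← Real.exp_add, sum_insert he]
          ring_nf

/-- Removing `T` embeds its supersets into all subsets, where the binomial theorem applies. -/
theorem sum_pow_card_superset_le {ι : Type*} [Fintype ι] [DecidableEq ι] (T : Finset ι) {a : ℝ}
    (ha : 0 ≤ a) : ∑ S with T ⊆ S, a ^ #S ≤ a ^ #T * (1 + a) ^ Fintype.card ι := by
  have h1 : ∑ S with T ⊆ S, a ^ #S = ∑ S with T ⊆ S, a ^ #T * a ^ #(S \ T) :=
    sum_congr rfl fun S hS => by
      rw [← pow_add, card_sdiff_of_subset (mem_filter.1 hS).2,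
        Nat.add_sub_cancel' (card_le_card (mem_filter.1 hS).2)]
  have h2 : ∑ S with T ⊆ S, a ^ #(S \ T) = ∑ S ∈ (univ.filter (T ⊆ ·)).image (· \ T), a ^ #S := by
    rw [sum_image]
    intro S hS S' hS' heq
    have hS1 : T ⊆ S := by simpa using hS
    have hS2 : T ⊆ S' := by simpa using hS'
    rw [← sdiff_union_of_subset hS1, ← sdiff_union_of_subset hS2]
    exact congrArg (· ∪ T) heq
  have h3 : ∑ S : Finset ι, a ^ #S = (1 + a) ^ Fintype.card ι := by
    rw [add_comm, ← Fintype.sum_pow_mul_eq_add_pow]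
    simp
  rw [h1, ← mul_sum, h2, ← h3]
  refine mul_le_mul_of_nonneg_left ?_ (pow_nonneg ha _)
  exact sum_le_sum_of_subset_of_nonneg (subset_univ _) fun _ _ _ => pow_nonneg ha _

/-! ### Perfect matchings and the points they cover -/

namespace PerfectMatching

variable {N : ℕ}

theorem eq_of_mem (M : PerfectMatching N) {e f : Finset (Fin N)} (he : e ∈ M.1) (hf : f ∈ M.1)
    {i : Fin N} (hie : i ∈ e) (hif : i ∈ f) : e = f :=
  (M.2.2 i).unique ⟨he, hie⟩ ⟨hf, hif⟩

theorem pairwiseDisjoint (M : PerfectMatching N) (S : Finset M.Pairs) :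
    (S : Set M.Pairs).PairwiseDisjoint (fun k => k.1) := by
  intro e _ f _ hef
  rw [Function.onFun, Finset.disjoint_left]
  intro i hie hif
  exact hef (Subtype.ext (M.eq_of_mem e.2 f.2 hie hif))

theorem two_mul_card (M : PerfectMatching N) : 2 * #M.1 = N := by
  classical
  have h := Finset.sum_card (B := M.1) (n := 1) (fun i => by
    rw [card_eq_one]
    obtain ⟨e, ⟨he, hie⟩, hu⟩ := M.2.2 i
    refine ⟨e, ?_⟩
    ext f
    simp only [mem_filter, mem_singleton]
    exact ⟨fun hf => hu f hf, fun hf => hf ▸ ⟨he, hie⟩⟩)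
  rw [sum_const_nat fun e he => M.2.1 e he] at h
  simp at h
  omega

/-- The set of points covered by a set of pairs. -/
def support (M : PerfectMatching N) (S : Finset M.Pairs) : Finset (Fin N) :=
  S.biUnion fun k => k.1

theorem mem_support {M : PerfectMatching N} {S : Finset M.Pairs} {i : Fin N} :
    i ∈ M.support S ↔ ∃ k ∈ S, i ∈ k.1 := by
  simp [support]

theorem mem_of_mem_support {M : PerfectMatching N} {S : Finset M.Pairs} {i : Fin N}
    (hi : i ∈ M.support S) {k : M.Pairs} (hk : i ∈ k.1) : k ∈ S := by
  obtain ⟨f, hf, hif⟩ := mem_support.1 hi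
  rwa [Subtype.ext (M.eq_of_mem k.2 f.2 hk hif)]

theorem support_injective (M : PerfectMatching N) : Function.Injective M.support := by
  have key : ∀ S S' : Finset M.Pairs, M.support S = M.support S' → S ⊆ S' := by
    intro S S' h k hk
    have hc : 0 < #k.1 := by rw [M.2.1 k.1 k.2]; norm_num
    obtain ⟨i, hi⟩ := card_pos.1 hc
    have : i ∈ M.support S := mem_support.2 ⟨k, hk, hi⟩
    exact mem_of_mem_support (h ▸ this) hi
  exact fun S S' h => (key S S' h).antisymm (key S' S h.symm)

theorem card_support (M : PerfectMatching N) (S : Finset M.Pairs) : #(M.support S) = 2 * #S := by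
  rw [support, card_biUnion (M.pairwiseDisjoint S), sum_const_nat fun k _ => M.2.1 k.1 k.2,
    mul_comm]

end PerfectMatching

/-! ### Fourier expansion of a tree component -/

theorem prod_support {N : ℕ} (M : PerfectMatching N) (S : Finset M.Pairs) (y : Cube N) :
    ∏ k ∈ S, ∏ i ∈ k.1, (-1 : ℝ) ^ (y i : ℕ) = ∏ i ∈ M.support S, (-1 : ℝ) ^ (y i : ℕ) := by
  rw [PerfectMatching.support, prod_biUnion (M.pairwiseDisjoint S)]

theorem treePmf_eq_sum {N : ℕ} (M : PerfectMatching N) (μ : M.Pairs → Fin 2) (δ : ℝ)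
    (y : Cube N) : treePmf M μ δ y = (1 / 2 ^ N) * ∑ S : Finset M.Pairs,
      (4 * δ) ^ #S * (∏ k ∈ S, (-1 : ℝ) ^ (μ k : ℕ)) *
        ∏ i ∈ M.support S, (-1 : ℝ) ^ (y i : ℕ) := by
  have h1 : treePmf M μ δ y = ∏ k : M.Pairs, (1 / 4 : ℝ) *
      (1 + 4 * δ * ((-1 : ℝ) ^ (μ k : ℕ) * ∏ i ∈ k.1, (-1 : ℝ) ^ (y i : ℕ))) :=
    prod_congr rfl fun k _ => by rw [pairPmf]; ring
  rw [h1, prod_mul_distrib, prod_const, card_univ, Fintype.card_coe, prod_one_add, powerset_univ]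
  congr 1
  · conv_rhs => rw [← M.two_mul_card, pow_mul, ← one_div_pow]
    norm_num
  · refine sum_congr rfl fun S _ => ?_
    rw [prod_mul_distrib, prod_const, prod_mul_distrib, prod_support, mul_assoc]

theorem treePmf_nonneg {N : ℕ} (M : PerfectMatching N) (μ : M.Pairs → Fin 2) {δ : ℝ}
    (h0 : 0 ≤ δ) (h1 : 4 * δ ≤ 1) (y : Cube N) : 0 ≤ treePmf M μ δ y := by
  refine prod_nonneg fun k _ => ?_
  have h : |(-1 : ℝ) ^ (μ k : ℕ) * δ * ∏ i ∈ k.1, (-1 : ℝ) ^ (y i : ℕ)| = δ := by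
    rw [abs_mul, abs_prod_neg_one_pow, abs_mul]
    simp [abs_of_nonneg h0]
  rw [pairPmf]
  linarith [neg_abs_le ((-1 : ℝ) ^ (μ k : ℕ) * δ * ∏ i ∈ k.1, (-1 : ℝ) ^ (y i : ℕ))]

/-- Orthogonality of the characters of the cube. -/
theorem sum_character_mul {N : ℕ} (A B : Finset (Fin N)) :
    ∑ y : Cube N, (∏ i ∈ A, (-1 : ℝ) ^ (y i : ℕ)) * ∏ i ∈ B, (-1 : ℝ) ^ (y i : ℕ) =
      if A = B then 2 ^ N else 0 := by
  have key : ∀ A B : Finset (Fin N), (∃ i, i ∈ A ∧ i ∉ B) →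
      ∑ y : Cube N, (∏ i ∈ A, (-1 : ℝ) ^ (y i : ℕ)) * ∏ i ∈ B, (-1 : ℝ) ^ (y i : ℕ) = 0 := by
    rintro A B ⟨j, hjA, hjB⟩
    -- Flipping bit `j` negates the first character and fixes the second, so the sum equals its own
    -- negative.
    have h := Equiv.sum_comp (Equiv.addRight (Pi.single j 1 : Cube N)) fun y : Cube N =>
      (∏ i ∈ A, (-1 : ℝ) ^ (y i : ℕ)) * ∏ i ∈ B, (-1 : ℝ) ^ (y i : ℕ)
    have h2 : ∀ (C : Finset (Fin N)), j ∉ C → ∀ y : Cube N,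
        ∏ i ∈ C, (-1 : ℝ) ^ ((y + Pi.single j 1 : Cube N) i : ℕ) =
          ∏ i ∈ C, (-1 : ℝ) ^ (y i : ℕ) := by
      intro C hC y
      refine prod_congr rfl fun i hi => ?_
      have : i ≠ j := fun hij => hC (hij ▸ hi)
      simp [this]
    have h1 : ∀ y : Cube N, ∏ i ∈ A, (-1 : ℝ) ^ ((y + Pi.single j 1 : Cube N) i : ℕ) =
        -∏ i ∈ A, (-1 : ℝ) ^ (y i : ℕ) := by
      intro y
      rw [← mul_prod_erase _ _ hjA, ← mul_prod_erase _ _ hjA, h2 _ (notMem_erase j A),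
        Pi.add_apply, Pi.single_eq_same, neg_one_pow_fin_two_add_one]
      ring
    simp only [Equiv.coe_addRight, h1, h2 B hjB, neg_mul, sum_neg_distrib] at h
    linarith
  split_ifs with hAB
  · subst hAB
    have : ∀ y : Cube N, (∏ i ∈ A, (-1 : ℝ) ^ (y i : ℕ)) * ∏ i ∈ A, (-1 : ℝ) ^ (y i : ℕ) = 1 := by
      intro y
      rw [← abs_mul_abs_self, abs_prod_neg_one_pow, mul_one]
    simp [this]
  · by_cases h : A ⊆ B
    · obtain ⟨i, hi⟩ : ∃ i, i ∈ B ∧ i ∉ A := by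
        by_contra! hc
        exact hAB (h.antisymm hc)
      rw [← key B A ⟨i, hi⟩]
      exact sum_congr rfl fun y _ => mul_comm _ _
    · exact key A B (not_subset.1 h)

/-! ### Correlation of two tree components -/

/-- The coefficients of the correlation of two tree components, as a multi-affine function of the
signs of the first one. -/
noncomputable def crossCoeff {N : ℕ} (M M' : PerfectMatching N) (μ' : M'.Pairs → Fin 2) (δ : ℝ)
    (S : Finset M.Pairs) : ℝ :=
  (4 * δ) ^ #S * ∑ S' : Finset M'.Pairs, if M.support S = M'.support S' then
    (4 * δ) ^ #S' * ∏ k ∈ S', (-1 : ℝ) ^ (μ' k : ℕ) else 0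

/-- Orthogonality keeps only those `S`, `S'` that cover the same points. -/
theorem sum_treePmf_mul_treePmf {N : ℕ} (M M' : PerfectMatching N) (μ : M.Pairs → Fin 2)
    (μ' : M'.Pairs → Fin 2) (δ : ℝ) :
    2 ^ N * ∑ y, treePmf M μ δ y * treePmf M' μ' δ y =
      ∑ S : Finset M.Pairs, crossCoeff M M' μ' δ S * ∏ k ∈ S, (-1 : ℝ) ^ (μ k : ℕ) := by
  simp only [treePmf_eq_sum, crossCoeff]
  have h1 : ∀ y : Cube N, (1 / 2 ^ N) * (∑ S : Finset M.Pairs,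
      (4 * δ) ^ #S * (∏ k ∈ S, (-1 : ℝ) ^ (μ k : ℕ)) * ∏ i ∈ M.support S, (-1 : ℝ) ^ (y i : ℕ)) *
      ((1 / 2 ^ N) * ∑ S : Finset M'.Pairs, (4 * δ) ^ #S * (∏ k ∈ S, (-1 : ℝ) ^ (μ' k : ℕ)) *
        ∏ i ∈ M'.support S, (-1 : ℝ) ^ (y i : ℕ)) =
      ∑ S : Finset M.Pairs, ∑ S' : Finset M'.Pairs, (1 / 2 ^ N) ^ 2 *
        ((4 * δ) ^ #S * (∏ k ∈ S, (-1 : ℝ) ^ (μ k : ℕ)) * ((4 * δ) ^ #S' *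
          (∏ k ∈ S', (-1 : ℝ) ^ (μ' k : ℕ)))) * ((∏ i ∈ M.support S, (-1 : ℝ) ^ (y i : ℕ)) *
            ∏ i ∈ M'.support S', (-1 : ℝ) ^ (y i : ℕ)) := by
    intro y
    rw [mul_mul_mul_comm, sum_mul_sum, mul_sum]
    refine sum_congr rfl fun S _ => ?_
    rw [mul_sum]
    refine sum_congr rfl fun S' _ => ?_
    ring
  rw [sum_congr rfl fun y _ => h1 y, sum_comm, mul_sum]
  refine sum_congr rfl fun S _ => ?_
  rw [sum_comm, mul_sum, mul_sum, sum_mul]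
  refine sum_congr rfl fun S' _ => ?_
  rw [← mul_sum, sum_character_mul]
  split_ifs
  · field_simp
  · simp

theorem crossCoeff_empty {N : ℕ} (M M' : PerfectMatching N) (μ' : M'.Pairs → Fin 2) (δ : ℝ) :
    crossCoeff M M' μ' δ ∅ = 1 := by
  have h : M.support ∅ = M'.support ∅ := rfl
  rw [crossCoeff, sum_eq_single ∅]
  · simp [h]
  · intro S _ hS
    rw [if_neg]
    rw [h]
    exact fun hc => hS (M'.support_injective hc).symm
  · simp

/-- A set of pairs is determined by its support, so at most one `S'` contributes, and it has the
same size as `S`. -/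
theorem abs_crossCoeff_le {N : ℕ} (M M' : PerfectMatching N) (μ' : M'.Pairs → Fin 2) (δ : ℝ)
    (S : Finset M.Pairs) : |crossCoeff M M' μ' δ S| ≤ ((4 * δ) ^ 2) ^ #S := by
  by_cases h : ∃ S', M.support S = M'.support S'
  · obtain ⟨S', hS'⟩ := h
    have hcard : #S = #S' := by
      have := congrArg card hS'
      rw [M.card_support, M'.card_support] at this
      omega
    rw [crossCoeff, sum_eq_single S']
    · rw [if_pos hS', abs_mul, abs_mul, abs_prod_neg_one_pow, mul_one, ← hcard, ← abs_mul,
        ← mul_pow, ← sq, abs_of_nonneg (by positivity)]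
    · intro S'' _ hne
      rw [if_neg]
      rw [hS']
      exact fun hc => hne (M'.support_injective hc).symm
    · simp
  · push Not at h
    simp only [crossCoeff, h, if_false, sum_const_zero, mul_zero, abs_zero]
    positivity

/-- A support common to both matchings is closed under both partner maps. From a point `i` of `e`,
the pair of `M'` at `i` leads to some `j` outside `e`; then `f` is the pair of `M` at `j`. -/
theorem exists_mem_of_crossCoeff_ne_zero {N : ℕ} (M M' : PerfectMatching N) (e : M.Pairs)
    (he : e.1 ∉ M'.1) : ∃ f : M.Pairs, f ≠ e ∧ ∀ (μ' : M'.Pairs → Fin 2) (δ : ℝ)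
      (S : Finset M.Pairs), e ∈ S → crossCoeff M M' μ' δ S ≠ 0 → f ∈ S := by
  obtain ⟨i, hi⟩ := card_pos.1 (by rw [M.2.1 e.1 e.2]; norm_num : 0 < #e.1)
  obtain ⟨e', ⟨he', hie'⟩, -⟩ := M'.2.2 i
  obtain ⟨j, hje', hje⟩ : ∃ j ∈ e', j ∉ e.1 := by
    by_contra! hc
    have : e' = e.1 := eq_of_subset_of_card_le hc (by rw [M.2.1 _ e.2, M'.2.1 _ he'])
    exact he (this ▸ he')
  obtain ⟨f, ⟨hf, hjf⟩, -⟩ := M.2.2 j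
  refine ⟨⟨f, hf⟩, fun h => hje (h ▸ hjf), fun μ' δ S heS hne => ?_⟩
  obtain ⟨S', hS'⟩ : ∃ S', M.support S = M'.support S' := by
    by_contra! hc
    simp [crossCoeff, hc] at hne
  have h1 : i ∈ M'.support S' := hS' ▸ PerfectMatching.mem_support.2 ⟨e, heS, hi⟩
  have h2 : (⟨e', he'⟩ : M'.Pairs) ∈ S' := PerfectMatching.mem_of_mem_support h1 hie'
  have h3 : j ∈ M.support S := hS' ▸ PerfectMatching.mem_support.2 ⟨_, h2, hje'⟩
  exact PerfectMatching.mem_of_mem_support h3 hjf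

/-- This bounds the influence of the sign of `e`. If `e` is not shared, the forced second pair `f`
gains another factor `(4δ)²`. -/
theorem sum_abs_crossCoeff_le {N : ℕ} (M M' : PerfectMatching N) (μ' : M'.Pairs → Fin 2) (δ : ℝ)
    (e : M.Pairs) : ∑ S with e ∈ S, |crossCoeff M M' μ' δ S| ≤
      (if e.1 ∈ M'.1 then (4 * δ) ^ 2 else ((4 * δ) ^ 2) ^ 2) *
        (1 + (4 * δ) ^ 2) ^ Fintype.card M.Pairs := by
  split_ifs with he
  · calc _ ≤ ∑ S with {e} ⊆ S, ((4 * δ) ^ 2) ^ #S := by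
          simp only [singleton_subset_iff]
          exact sum_le_sum fun S _ => abs_crossCoeff_le ..
      _ ≤ _ := by simpa using sum_pow_card_superset_le {e} (sq_nonneg (4 * δ))
  · obtain ⟨f, hfe, hf⟩ := exists_mem_of_crossCoeff_ne_zero M M' e he
    calc _ ≤ ∑ S with {f, e} ⊆ S, |crossCoeff M M' μ' δ S| := by
          rw [← sum_filter_ne_zero (univ.filter (e ∈ ·))]
          refine sum_le_sum_of_subset_of_nonneg ?_ fun _ _ _ => abs_nonneg _
          intro S hS
          simp only [mem_filter, mem_univ, true_and, ne_eq, abs_eq_zero] at hS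
          simp only [mem_filter, mem_univ, true_and, insert_subset_iff, singleton_subset_iff]
          exact ⟨hf μ' δ S hS.1 hS.2, hS.1⟩
      _ ≤ ∑ S with {f, e} ⊆ S, ((4 * δ) ^ 2) ^ #S := sum_le_sum fun S _ => abs_crossCoeff_le ..
      _ ≤ _ := by
          have := sum_pow_card_superset_le {f, e} (sq_nonneg (4 * δ))
          rwa [card_pair hfe] at this

/-- The exponential moment of the correlation of two tree components over the signs of the first. -/
theorem expect_exp_sum_treePmf_mul_treePmf_le {N : ℕ} (M M' : PerfectMatching N)
    (μ' : M'.Pairs → Fin 2) (δ t : ℝ) :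
    𝔼 μ : M.Pairs → Fin 2, Real.exp (t * (2 ^ N * ∑ y, treePmf M μ δ y * treePmf M' μ' δ y - 1)) ≤
      Real.exp (t ^ 2 / 2 * ((1 + (4 * δ) ^ 2) ^ N * ((4 * δ) ^ 4 * #(M.1 ∩ M'.1) +
        (4 * δ) ^ 8 * N))) := by
  set a := (4 * δ) ^ 2 with ha
  have ha0 : 0 ≤ a := sq_nonneg _
  have hK : Fintype.card M.Pairs * 2 = N := by
    rw [Fintype.card_coe, mul_comm, M.two_mul_card]
  have h := expect_exp_multiaffine_le (crossCoeff M M' μ' δ) _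
    (sum_abs_crossCoeff_le M M' μ' δ) t univ
  simp only [powerset_univ, ← sum_treePmf_mul_treePmf, crossCoeff_empty] at h
  -- The factor `exp (-t)` cancels the constant coefficient 1.
  have h1 : ∀ μ : M.Pairs → Fin 2,
      Real.exp (t * (2 ^ N * ∑ y, treePmf M μ δ y * treePmf M' μ' δ y - 1)) =
        Real.exp (-t) * Real.exp (t * (2 ^ N * ∑ y, treePmf M μ δ y * treePmf M' μ' δ y)) := by
    intro μ
    rw [← Real.exp_add]
    ring_nf
  simp only [h1, ← mul_expect]
  refine (mul_le_mul_of_nonneg_left h (Real.exp_nonneg _)).trans ?_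
  rw [← Real.exp_add, Real.exp_le_exp, ← ha]
  have h2 : ∑ e : M.Pairs, ((if e.1 ∈ M'.1 then a else a ^ 2) *
      (1 + a) ^ Fintype.card M.Pairs) ^ 2 ≤
      (1 + a) ^ N * (a ^ 2 * #(M.1 ∩ M'.1) + a ^ 4 * N) := by
    simp only [mul_pow, ← pow_mul, hK, ← sum_mul]
    rw [mul_comm]
    refine mul_le_mul_of_nonneg_left ?_ (by positivity)
    have h3 : ∀ e : M.Pairs, (if e.1 ∈ M'.1 then a else a ^ 2) ^ 2 ≤
        (if e.1 ∈ M'.1 then a ^ 2 else 0) + a ^ 4 := by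
      intro e
      split_ifs
      · have := pow_nonneg ha0 4
        linarith
      · exact le_of_eq (by ring)
    refine (sum_le_sum fun e _ => h3 e).trans ?_
    rw [sum_add_distrib, sum_coe_sort M.1 (fun e => if e ∈ M'.1 then a ^ 2 else 0), ← sum_filter,
      filter_mem_eq_inter, sum_const, sum_const, card_univ, nsmul_eq_mul, nsmul_eq_mul, mul_comm,
      mul_comm (_ : ℝ) (a ^ 4)]
    gcongr
    omega
  have e4 : (4 * δ) ^ 4 = a ^ 2 := by rw [ha]; ring
  have e8 : (4 * δ) ^ 8 = a ^ 4 := by rw [ha]; ring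
  rw [e4, e8]
  nlinarith [sq_nonneg t, mul_le_mul_of_nonneg_left h2 (by positivity : 0 ≤ t ^ 2 / 2)]

/-! ### Common pairs with a random perfect matching -/

namespace PerfectMatching

variable {N : ℕ}

/-- Relabelling the points of a perfect matching. -/
def relabel (σ : Equiv.Perm (Fin N)) (M : PerfectMatching N) : PerfectMatching N :=
  ⟨M.1.map (mapEmbedding σ.toEmbedding).toEmbedding, by
    constructor
    · intro e he
      obtain ⟨f, hf, rfl⟩ := mem_map.1 he
      simpa using M.2.1 f hf
    · intro i
      obtain ⟨e, ⟨he, hie⟩, hu⟩ := M.2.2 (σ.symm i)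
      refine ⟨e.map σ.toEmbedding, ⟨mem_map.2 ⟨e, he, rfl⟩, ?_⟩, ?_⟩
      · simpa using hie
      · rintro f ⟨hf, hif⟩
        obtain ⟨g, hg, rfl⟩ := mem_map.1 hf
        have : σ.symm i ∈ g := by simpa using hif
        rw [hu g ⟨hg, this⟩]
        rfl⟩

theorem map_mem_relabel (σ : Equiv.Perm (Fin N)) {M : PerfectMatching N} {e : Finset (Fin N)}
    (he : e ∈ M.1) : e.map σ.toEmbedding ∈ (relabel σ M).1 :=
  mem_map.2 ⟨e, he, rfl⟩

theorem relabel_injective (σ : Equiv.Perm (Fin N)) : Function.Injective (relabel σ) := by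
  intro M M' h
  exact Subtype.ext (map_injective _ (congrArg Subtype.val h))

theorem map_swap_eq_self {v w : Fin N} {e : Finset (Fin N)} (hv : v ∉ e) (hw : w ∉ e) :
    e.map (Equiv.swap v w).toEmbedding = e := by
  refine eq_of_subset_of_card_le ?_ (by simp)
  intro i hi
  obtain ⟨j, hj, rfl⟩ := mem_map.1 hi
  have h1 : j ≠ v := fun h => hv (h ▸ hj)
  have h2 : j ≠ w := fun h => hw (h ▸ hj)
  simpa [Equiv.swap_apply_of_ne_of_ne h1 h2] using hj

open Classical in
/-- The partner of a point can be switched to any point that is not covered by a given set of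
pairs. -/
theorem card_superset_insert_mul_le (M : PerfectMatching N) {S : Finset (Finset (Fin N))}
    (hS : S ⊆ M.1) {e : Finset (Fin N)} (he : e ∈ M.1) (heS : e ∉ S) :
    #{L : PerfectMatching N | insert e S ⊆ L.1} * (N - 2 * #S - 1) ≤
      #{L : PerfectMatching N | S ⊆ L.1} := by
  obtain ⟨v, w, hvw, rfl⟩ := card_eq_two.1 (M.2.1 e he)
  have hvS : ∀ f ∈ S, v ∉ f := fun f hf hvf =>
    heS ((M.eq_of_mem he (hS hf) (by simp) hvf) ▸ hf)
  have hwS : ∀ f ∈ S, w ∉ f := fun f hf hwf =>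
    heS ((M.eq_of_mem he (hS hf) (by simp) hwf) ▸ hf)
  -- `U` holds the possible partners of `v`, including `w` itself. The swap of `w` and `u` fixes
  -- every pair of `S`, and `u` is recovered as the new partner of `v`.
  set U : Finset (Fin N) := (univ \ S.biUnion id).erase v with hU
  have hUcard : #U = N - 2 * #S - 1 := by
    rw [hU, card_erase_of_mem, card_sdiff_of_subset (subset_univ _), card_univ, Fintype.card_fin,
      card_biUnion, sum_const_nat (m := 2), mul_comm]
    · exact fun f hf => M.2.1 f (hS hf)
    · intro f hf g hg hfg
      rw [Function.onFun, Finset.disjoint_left]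
      exact fun i hif hig => hfg (M.eq_of_mem (hS hf) (hS hg) hif hig)
    · simpa using hvS
  have hUv : ∀ u ∈ U, v ≠ u := fun u hu => (ne_of_mem_erase hu).symm
  have hUS : ∀ u ∈ U, ∀ f ∈ S, u ∉ f := by
    intro u hu
    simpa using (mem_sdiff.1 (mem_of_mem_erase hu)).2
  have hpair : ∀ u ∈ U, ∀ L : PerfectMatching N, {v, w} ∈ L.1 →
      {v, u} ∈ (relabel (Equiv.swap w u) L).1 := by
    intro u hu L hL
    have := map_mem_relabel (Equiv.swap w u) hL
    simpa [map_insert, Equiv.swap_apply_of_ne_of_ne hvw (hUv u hu)] using this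
  rw [← hUcard, ← card_product]
  refine card_le_card_of_injOn (fun p => relabel (Equiv.swap w p.2) p.1) ?_ ?_
  · rintro ⟨L, u⟩ hp
    obtain ⟨hL, hu⟩ := mem_product.1 (mem_coe.1 hp)
    have hL' : insert {v, w} S ⊆ L.1 := by simpa using hL
    simp only [coe_filter, mem_univ, true_and, Set.mem_ofPred_eq]
    intro f hf
    have := map_mem_relabel (Equiv.swap w u) (hL' (mem_insert_of_mem hf))
    rwa [map_swap_eq_self (hwS f hf) (hUS u hu f hf)] at this
  · rintro ⟨L, u⟩ hp ⟨L', u'⟩ hp' heq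
    obtain ⟨hL, hu⟩ := mem_product.1 (mem_coe.1 hp)
    obtain ⟨hL', hu'⟩ := mem_product.1 (mem_coe.1 hp')
    simp only at hL hu hL' hu' heq
    have h1 := hpair u hu L ((mem_filter.1 hL).2 (mem_insert_self _ _))
    have h2 := hpair u' hu' L' ((mem_filter.1 hL').2 (mem_insert_self _ _))
    rw [← heq] at h2
    have h3 := eq_of_mem _ h1 h2 (i := v) (by simp) (by simp)
    have h4 : u ∈ ({v, u'} : Finset (Fin N)) := h3 ▸ (by simp)
    have h5 : u = u' := by simpa [(hUv u hu).symm] using h4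
    subst h5
    rw [relabel_injective _ heq]

open Classical in
-- Each added pair costs a factor `N - 2 #S - 1 ≥ #M.1 - #S`, since `N = 2 #M.1`. The descending
-- factorial so obtained is weakened to a binomial coefficient, which later cancels the number of
-- sets of each size and leaves a geometric series.
theorem card_superset_mul_choose_le (M : PerfectMatching N) (S : Finset (Finset (Fin N)))
    (hS : S ⊆ M.1) : #{L : PerfectMatching N | S ⊆ L.1} * (#M.1).choose #S ≤
      Fintype.card (PerfectMatching N) := by
  refine (Nat.mul_le_mul_left _ (Nat.choose_le_descFactorial _ _)).trans ?_
  induction S using Finset.induction_on with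
  | empty => simp
  | insert e S he ih =>
    have hS' := (subset_insert e S).trans hS
    rw [card_insert_of_notMem he, Nat.descFactorial_succ, ← mul_assoc]
    refine le_trans (Nat.mul_le_mul_right _ ?_) (ih hS')
    refine le_trans (Nat.mul_le_mul_left _ ?_)
      (card_superset_insert_mul_le M hS' (hS (mem_insert_self e S)) he)
    have h1 := M.two_mul_card
    have h2 : #S < #M.1 := by
      have := card_le_card hS
      rwa [card_insert_of_notMem he] at this
    omega

/-- The exponential moment of the number of common pairs with a random perfect matching. -/
theorem expect_one_add_pow_card_inter_le (M : PerfectMatching N) {s : ℝ} (h0 : 0 ≤ s)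
    (h1 : s < 1) : 𝔼 L : PerfectMatching N, (1 + s) ^ #(L.1 ∩ M.1) ≤ 1 / (1 - s) := by
  classical
  have hpos : (0 : ℝ) < Fintype.card (PerfectMatching N) := by
    have : 0 < Fintype.card (PerfectMatching N) := Fintype.card_pos_iff.2 ⟨M⟩
    exact_mod_cast this
  have hexp : ∀ L : PerfectMatching N, (1 + s) ^ #(L.1 ∩ M.1) =
      ∑ S ∈ M.1.powerset, if S ⊆ L.1 then s ^ #S else 0 := by
    intro L
    rw [add_comm, ← sum_pow_mul_eq_add_pow, ← sum_filter]
    refine sum_congr ?_ fun S _ => by simp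
    ext S
    simp only [mem_powerset, mem_filter, subset_inter_iff, and_comm]
  rw [Fintype.expect_eq_sum_div_card, div_le_iff₀ hpos]
  simp only [hexp]
  rw [sum_comm]
  have h2 : ∀ S ∈ M.1.powerset, ∑ L : PerfectMatching N, (if S ⊆ L.1 then s ^ #S else 0) ≤
      s ^ #S * (Fintype.card (PerfectMatching N) / (#M.1).choose #S) := by
    intro S hS
    have hS' := mem_powerset.1 hS
    rw [← sum_filter, sum_const, nsmul_eq_mul, mul_comm]
    refine mul_le_mul_of_nonneg_left ?_ (pow_nonneg h0 _)
    have hc : (0 : ℝ) < (#M.1).choose #S := by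
      exact_mod_cast Nat.choose_pos (card_le_card hS')
    rw [le_div_iff₀ hc]
    exact_mod_cast card_superset_mul_choose_le M S hS'
  refine (sum_le_sum h2).trans ?_
  rw [sum_powerset_apply_card
    (fun k => s ^ k * ((Fintype.card (PerfectMatching N) : ℝ) / (#M.1).choose k))]
  have h3 : ∀ k ∈ range (#M.1 + 1), (#M.1).choose k •
      (s ^ k * ((Fintype.card (PerfectMatching N) : ℝ) / (#M.1).choose k)) =
        s ^ k * Fintype.card (PerfectMatching N) := by
    intro k hk
    have hc : ((#M.1).choose k : ℝ) ≠ 0 := by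
      exact_mod_cast (Nat.choose_pos (Nat.lt_succ_iff.1 (mem_range.1 hk))).ne'
    rw [nsmul_eq_mul]
    field_simp
  rw [sum_congr rfl h3, ← sum_mul]
  refine mul_le_mul_of_nonneg_right ?_ hpos.le
  rw [one_div, ← tsum_geometric_of_lt_one h0 h1]
  exact (summable_geometric_of_lt_one h0 h1).sum_le_tsum _ fun _ _ => pow_nonneg h0 _

end PerfectMatching

/-! ### Second moment of the random mixture -/

theorem expect_prod_pi {κ α : Type*} [Fintype κ] [DecidableEq κ] [Fintype α]
    (F : κ → α → ℝ) : 𝔼 ν : κ → α, ∏ l, F l (ν l) = ∏ l, 𝔼 y, F l y := by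
  simp only [Fintype.expect_eq_sum_div_card]
  rw [prod_div_distrib, Fintype.prod_sum, prod_const, Fintype.card_fun, card_univ]
  push_cast
  rfl

theorem mixturePmf_eq {n d : ℕ} (hd : 1 ≤ d) (hdn : d ≤ n) (M : PerfectMatching (n - d + 1))
    (μ : Fin (2 ^ (d - 1)) → M.Pairs → Fin 2) (δ : ℝ) (x : Cube n) :
    mixturePmf hd hdn M μ δ x = (1 / (2 : ℝ) ^ (d - 1)) *
      treePmf M (μ (finFunctionFinEquiv (pointerBits hd hdn x))) δ (childBits hd hdn x) := by
  simp [mixturePmf]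

theorem bijective_pointerBits_childBits {n d : ℕ} (hd : 1 ≤ d) (hdn : d ≤ n) :
    Function.Bijective fun x : Cube n => (pointerBits hd hdn x, childBits hd hdn x) := by
  rw [Fintype.bijective_iff_injective_and_card]
  constructor
  · intro x y h
    obtain ⟨h1, h2⟩ := Prod.mk.inj h
    funext i
    by_cases hi : (i : ℕ) < d - 1
    · exact congrFun h1 ⟨i, hi⟩
    · have h3 := congrFun h2 ⟨i - (d - 1), by omega⟩
      have h4 : (⟨d - 1 + (i - (d - 1)), by omega⟩ : Fin n) = i := Fin.ext (by simp; omega)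
      simp only [childBits, h4] at h3
      exact h3
  · simp only [Fintype.card_prod, Fintype.card_fun, Fintype.card_fin, ← pow_add]
    congr 1
    omega

/-- Both mixtures read the same pointer bits, so only components with equal index meet. -/
theorem sum_mixturePmf_mul_mixturePmf {n d : ℕ} (hd : 1 ≤ d) (hdn : d ≤ n)
    (M L : PerfectMatching (n - d + 1)) (μ : Fin (2 ^ (d - 1)) → M.Pairs → Fin 2)
    (ν : Fin (2 ^ (d - 1)) → L.Pairs → Fin 2) (δ : ℝ) :
    2 ^ n * ∑ x, mixturePmf hd hdn L ν δ x * mixturePmf hd hdn M μ δ x =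
      (1 / (2 : ℝ) ^ (d - 1)) * ∑ l, (2 ^ (n - d + 1) *
        ∑ y, treePmf L (ν l) δ y * treePmf M (μ l) δ y) := by
  simp only [mixturePmf_eq]
  have h := Function.Bijective.sum_comp (bijective_pointerBits_childBits hd hdn)
    (fun p : Cube (d - 1) × Cube (n - d + 1) => (1 / (2 : ℝ) ^ (d - 1)) *
      treePmf L (ν (finFunctionFinEquiv p.1)) δ p.2 * ((1 / (2 : ℝ) ^ (d - 1)) *
        treePmf M (μ (finFunctionFinEquiv p.1)) δ p.2))
  simp only at h
  rw [h, Fintype.sum_prod_type, ← Equiv.sum_comp finFunctionFinEquiv, mul_sum, mul_sum]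
  refine sum_congr rfl fun p _ => ?_
  have hn : (2 : ℝ) ^ n = 2 ^ (d - 1) * 2 ^ (n - d + 1) := by
    rw [← pow_add]
    congr 1
    omega
  rw [hn, mul_sum, mul_sum, mul_sum]
  refine sum_congr rfl fun y _ => ?_
  field_simp

theorem mixturePmf_nonneg {n d : ℕ} (hd : 1 ≤ d) (hdn : d ≤ n) (M : PerfectMatching (n - d + 1))
    (μ : Fin (2 ^ (d - 1)) → M.Pairs → Fin 2) {δ : ℝ} (h0 : 0 ≤ δ) (h1 : 4 * δ ≤ 1)
    (x : Cube n) : 0 ≤ mixturePmf hd hdn M μ δ x := by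
  rw [mixturePmf_eq]
  exact mul_nonneg (by positivity) (treePmf_nonneg M _ h0 h1 _)

/-- The average over the signs of the first mixture of the correlation of the `m`-sample laws of
two mixtures of trees. -/
theorem expect_sign_correlation_pow_le {n d : ℕ} (hd : 1 ≤ d) (hdn : d ≤ n)
    (M L : PerfectMatching (n - d + 1)) (μ : Fin (2 ^ (d - 1)) → M.Pairs → Fin 2) {δ : ℝ}
    (h0 : 0 ≤ δ) (h1 : 4 * δ ≤ 1) (m : ℕ) :
    𝔼 ν : Fin (2 ^ (d - 1)) → L.Pairs → Fin 2,
      (2 ^ n * ∑ x, mixturePmf hd hdn L ν δ x * mixturePmf hd hdn M μ δ x) ^ m ≤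
        Real.exp ((m : ℝ) ^ 2 / (2 * 2 ^ (d - 1)) * ((1 + (4 * δ) ^ 2) ^ (n - d + 1) *
          ((4 * δ) ^ 4 * #(L.1 ∩ M.1) + (4 * δ) ^ 8 * ((n - d + 1 : ℕ) : ℝ)))) := by
  set D : ℝ := 2 ^ (d - 1) with hD
  have hDpos : 0 < D := by positivity
  have hpt : ∀ ν : Fin (2 ^ (d - 1)) → L.Pairs → Fin 2,
      (2 ^ n * ∑ x, mixturePmf hd hdn L ν δ x * mixturePmf hd hdn M μ δ x) ^ m ≤
        ∏ l, Real.exp (m / D * (2 ^ (n - d + 1) * ∑ y, treePmf L (ν l) δ y * treePmf M (μ l) δ y - 1)) := by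
    intro ν
    have hz : 0 ≤ 2 ^ n * ∑ x, mixturePmf hd hdn L ν δ x * mixturePmf hd hdn M μ δ x :=
      mul_nonneg (by positivity) (sum_nonneg fun x _ =>
        mul_nonneg (mixturePmf_nonneg hd hdn L ν h0 h1 x) (mixturePmf_nonneg hd hdn M μ h0 h1 x))
    set z := 2 ^ n * ∑ x, mixturePmf hd hdn L ν δ x * mixturePmf hd hdn M μ δ x with hzdef
    -- From `z ≤ exp (z - 1)`; the exponent is additive over the pointers, unlike the power.
    have hz1 : z ^ m ≤ Real.exp (m * (z - 1)) := by
      rw [Real.exp_nat_mul]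
      refine pow_le_pow_left₀ hz ?_ m
      linarith [Real.add_one_le_exp (z - 1)]
    refine hz1.trans_eq ?_
    rw [← Real.exp_sum, ← mul_sum, sum_sub_distrib, hzdef, sum_mixturePmf_mul_mixturePmf]
    simp only [sum_const, card_univ, Fintype.card_fin, nsmul_eq_mul, mul_one]
    push_cast
    rw [← hD]
    congr 1
    field_simp
  refine (expect_le_expect fun ν _ => hpt ν).trans ?_
  rw [expect_prod_pi (fun l (ξ : L.Pairs → Fin 2) =>
    Real.exp (m / D * (2 ^ (n - d + 1) * ∑ y, treePmf L ξ δ y * treePmf M (μ l) δ y - 1)))]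
  refine (prod_le_prod (fun l _ => expect_nonneg fun _ _ => Real.exp_nonneg _) fun l _ =>
    expect_exp_sum_treePmf_mul_treePmf_le L M (μ l) δ (m / D)).trans_eq ?_
  rw [prod_const, card_univ, Fintype.card_fin, ← Real.exp_nat_mul]
  push_cast
  rw [← hD]
  congr 1
  field_simp

/-- The `m`-sample second moment is close to one below the sample complexity threshold. -/
theorem expect_correlation_pow_le {n d : ℕ} (hd : 1 ≤ d) (hdn : d ≤ n)
    (M : PerfectMatching (n - d + 1)) (μ : Fin (2 ^ (d - 1)) → M.Pairs → Fin 2) {ε : ℝ}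
    (h0 : 0 < ε) (h1 : ε ≤ 1) (hn : 16 ≤ n) (m : ℕ)
    (hm : (m : ℝ) ^ 2 ≤ 2 ^ d * n ^ 2 / ε ^ 4 / (512 ^ 2 * Real.exp 16)) :
    𝔼 L : PerfectMatching (n - d + 1), 𝔼 ν : Fin (2 ^ (d - 1)) → L.Pairs → Fin 2,
      (2 ^ n * ∑ x, mixturePmf hd hdn L ν (ε / √n) x * mixturePmf hd hdn M μ (ε / √n) x) ^ m ≤
        5 / 4 := by
  have hnR : (16 : ℝ) ≤ n := by exact_mod_cast hn
  have hn0 : (0 : ℝ) < n := by linarith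
  set δ := ε / √n with hδ
  have hδ0 : 0 ≤ δ := by positivity
  have hδ2 : (4 * δ) ^ 2 = 16 * ε ^ 2 / n := by
    rw [hδ, mul_pow, div_pow, Real.sq_sqrt hn0.le]
    ring
  set a := (4 * δ) ^ 2 with ha
  have ha0 : 0 ≤ a := sq_nonneg _
  have hε2 : ε ^ 2 ≤ 1 := pow_le_one₀ h0.le h1
  have han : a * n ≤ 16 := by
    rw [hδ2, div_mul_cancel₀ _ hn0.ne']
    linarith
  have ha1 : a ≤ 1 := by
    rw [hδ2, div_le_one hn0]
    linarith
  have hδ1 : 4 * δ ≤ 1 := by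
    rw [ha] at ha1
    exact (sq_le_one_iff₀ (by positivity)).1 ha1
  have hNn : ((n - d + 1 : ℕ) : ℝ) ≤ n := by
    have : n - d + 1 ≤ n := by omega
    exact_mod_cast this
  have hpow : (1 + a) ^ (n - d + 1) ≤ Real.exp 16 := by
    calc (1 + a) ^ (n - d + 1) ≤ Real.exp a ^ (n - d + 1) :=
          pow_le_pow_left₀ (by positivity) (by linarith [Real.add_one_le_exp a]) _
      _ = Real.exp ((n - d + 1 : ℕ) * a) := by rw [Real.exp_nat_mul]
      _ ≤ Real.exp 16 := Real.exp_le_exp.2 (by nlinarith)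
  -- `κ = 16² / 512²`: the numerator comes from `a² = 16² ε⁴ / n²`, the denominator from the bound
  -- on `m²`.
  set κ : ℝ := 1 / 1024 with hκ
  have hcoef : (m : ℝ) ^ 2 / (2 * 2 ^ (d - 1)) * Real.exp 16 * a ^ 2 ≤ κ := by
    have h2d : (2 : ℝ) * 2 ^ (d - 1) = 2 ^ d := by
      rw [← pow_succ']
      congr 1
      omega
    rw [h2d, hδ2, div_pow]
    have hE := Real.exp_pos 16
    calc (m : ℝ) ^ 2 / 2 ^ d * Real.exp 16 * ((16 * ε ^ 2) ^ 2 / n ^ 2)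
        ≤ (2 ^ d * n ^ 2 / ε ^ 4 / (512 ^ 2 * Real.exp 16)) / 2 ^ d * Real.exp 16 *
            ((16 * ε ^ 2) ^ 2 / n ^ 2) := by gcongr
      _ = κ := by
        rw [hκ]
        field_simp
        norm_num
  have hL : ∀ L : PerfectMatching (n - d + 1), 𝔼 ν : Fin (2 ^ (d - 1)) → L.Pairs → Fin 2,
      (2 ^ n * ∑ x, mixturePmf hd hdn L ν δ x * mixturePmf hd hdn M μ δ x) ^ m ≤
        Real.exp (16 * κ) * (1 + (Real.exp κ - 1)) ^ #(L.1 ∩ M.1) := by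
    intro L
    refine (expect_sign_correlation_pow_le hd hdn M L μ hδ0 hδ1 m).trans ?_
    rw [add_sub_cancel, ← Real.exp_nat_mul, ← Real.exp_add, Real.exp_le_exp]
    have e4 : (4 * δ) ^ 4 = a ^ 2 := by rw [ha]; ring
    have e8 : (4 * δ) ^ 8 = a ^ 2 * a ^ 2 := by rw [ha]; ring
    rw [← ha, e4, e8]
    have hR : (0 : ℝ) ≤ #(L.1 ∩ M.1) := Nat.cast_nonneg _
    -- All the pairs that are not shared thus weigh no more than 16 shared ones.
    have hq : a ^ 2 * (n - d + 1 : ℕ) ≤ 16 := by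
      have : a ^ 2 * (n - d + 1 : ℕ) ≤ a * n := mul_le_mul (by nlinarith) hNn (Nat.cast_nonneg _) ha0
      linarith
    calc (m : ℝ) ^ 2 / (2 * 2 ^ (d - 1)) * ((1 + a) ^ (n - d + 1) *
          (a ^ 2 * #(L.1 ∩ M.1) + a ^ 2 * a ^ 2 * (n - d + 1 : ℕ)))
        ≤ (m : ℝ) ^ 2 / (2 * 2 ^ (d - 1)) * (Real.exp 16 *
          (a ^ 2 * #(L.1 ∩ M.1) + a ^ 2 * a ^ 2 * (n - d + 1 : ℕ))) := by gcongr
      _ = ((m : ℝ) ^ 2 / (2 * 2 ^ (d - 1)) * Real.exp 16 * a ^ 2) *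
          (#(L.1 ∩ M.1) + a ^ 2 * (n - d + 1 : ℕ)) := by ring
      _ ≤ κ * (#(L.1 ∩ M.1) + 16) := by gcongr
      _ = _ := by ring
  have hexp : Real.exp κ ≤ 1 + 2 * κ := by
    have := Real.abs_exp_sub_one_le (x := κ) (by rw [hκ]; norm_num)
    rw [abs_of_nonneg (by rw [hκ]; norm_num : 0 ≤ κ)] at this
    linarith [le_abs_self (Real.exp κ - 1)]
  have hexp16 : Real.exp (16 * κ) ≤ 1 + 2 * (16 * κ) := by
    have := Real.abs_exp_sub_one_le (x := 16 * κ) (by rw [hκ]; norm_num)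
    rw [abs_of_nonneg (by rw [hκ]; norm_num : 0 ≤ 16 * κ)] at this
    linarith [le_abs_self (Real.exp (16 * κ) - 1)]
  have hs0 : 0 ≤ Real.exp κ - 1 := by
    linarith [Real.one_le_exp (by rw [hκ]; norm_num : 0 ≤ κ)]
  have hs1 : Real.exp κ - 1 ≤ 1 / 512 := by
    rw [hκ] at hexp ⊢
    linarith
  calc _ ≤ 𝔼 L : PerfectMatching (n - d + 1), Real.exp (16 * κ) *
        (1 + (Real.exp κ - 1)) ^ #(L.1 ∩ M.1) := expect_le_expect fun L _ => hL L
    _ ≤ (1 + 2 * (16 * κ)) * (1 / (1 - 1 / 512)) := by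
      rw [← mul_expect]
      refine mul_le_mul hexp16 ?_ (expect_nonneg fun _ _ => by positivity) (by positivity)
      refine (M.expect_one_add_pow_card_inter_le hs0 (by linarith)).trans ?_
      exact one_div_le_one_div_of_le (by norm_num) (by linarith)
    _ ≤ 5 / 4 := by rw [hκ]; norm_num

/-! ### From a test to the second moment -/

theorem sum_prod_mul_prod {n : ℕ} (m : ℕ) (P Q : Cube n → ℝ) :
    ∑ x : Fin m → Cube n, (∏ s, P (x s)) * ∏ s, Q (x s) = (∑ y, P y * Q y) ^ m := by
  simp only [← prod_mul_distrib]
  rw [← Fintype.prod_sum (fun (_ : Fin m) y => P y * Q y), prod_const, card_univ, Fintype.card_fin]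

/-- If a test accepts the uniform distribution and rejects a mixture, each with probability at
least `2/3`, then the second moment of the likelihood ratio is at least `4/3`. -/
theorem four_thirds_le_second_moment {n m : ℕ} (T : Test n m) (A : (Fin m → Cube n) → ℝ)
    (hU : 2 / 3 ≤ probUniform T (uniformPmf n)) (hA : 2 / 3 ≤ ∑ x, A x * (1 - (T x : ℝ))) :
    4 / 3 ≤ (2 ^ n) ^ m * ∑ x, A x * A x := by
  set q : ℝ := (2 ^ n) ^ m with hq
  have hq0 : 0 < q := by positivity
  have hcard : ∑ _x : Fin m → Cube n, (1 : ℝ) = q := by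
    simp [hq]
  have hT : 2 / 3 * q ≤ ∑ x, (T x : ℝ) := by
    have h : probUniform T (uniformPmf n) = (∑ x, (T x : ℝ)) / q := by
      simp [probUniform, uniformPmf, ← mul_sum, hq, div_eq_inv_mul]
    rw [h] at hU
    exact (le_div_iff₀ hq0).1 hU
  -- Values in `[0, 1]` dominate their squares. Cauchy–Schwarz then gives `4/9 ≤ (q/3) ∑ A²`.
  have hsq : ∑ x, (1 - (T x : ℝ)) ^ 2 ≤ q / 3 := by
    calc ∑ x, (1 - (T x : ℝ)) ^ 2 ≤ ∑ x, (1 - (T x : ℝ)) := by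
          refine sum_le_sum fun x _ => ?_
          nlinarith [(T x).2.1, (T x).2.2]
      _ ≤ q / 3 := by
          rw [sum_sub_distrib, hcard]
          linarith
  have hcs := sum_mul_sq_le_sq_mul_sq univ A fun x => 1 - (T x : ℝ)
  have h1 : (2 / 3 : ℝ) ^ 2 ≤ (∑ x, A x * (1 - (T x : ℝ))) ^ 2 :=
    pow_le_pow_left₀ (by norm_num) hA 2
  have h2 : (∑ x, A x ^ 2) * ∑ x, (1 - (T x : ℝ)) ^ 2 ≤ (∑ x, A x ^ 2) * (q / 3) :=
    mul_le_mul_of_nonneg_left hsq (sum_nonneg fun x _ => sq_nonneg _)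
  simp only [← sq (A _)]
  nlinarith

/-- The density of `m` samples from a random mixture of trees. -/
noncomputable def averagePmf {n d : ℕ} (hd : 1 ≤ d) (hdn : d ≤ n) (δ : ℝ) (m : ℕ)
    (x : Fin m → Cube n) : ℝ :=
  𝔼 M : PerfectMatching (n - d + 1), 𝔼 μ : Fin (2 ^ (d - 1)) → M.Pairs → Fin 2,
    ∏ s, mixturePmf hd hdn M μ δ (x s)

theorem sum_averagePmf_mul {n d m : ℕ} (hd : 1 ≤ d) (hdn : d ≤ n) (δ : ℝ)
    (f : (Fin m → Cube n) → ℝ) : ∑ x, averagePmf hd hdn δ m x * f x =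
      𝔼 M : PerfectMatching (n - d + 1), 𝔼 μ : Fin (2 ^ (d - 1)) → M.Pairs → Fin 2,
        ∑ x, (∏ s, mixturePmf hd hdn M μ δ (x s)) * f x := by
  simp only [averagePmf, expect_mul, ← expect_sum_comm]

/-- Both averages are expanded; independence of the samples turns each inner sum into an `m`-th
power. -/
theorem second_moment_averagePmf {n d : ℕ} (hd : 1 ≤ d) (hdn : d ≤ n) (δ : ℝ) (m : ℕ) :
    (2 ^ n) ^ m * ∑ x, averagePmf hd hdn δ m x * averagePmf hd hdn δ m x =
      𝔼 M : PerfectMatching (n - d + 1), 𝔼 μ : Fin (2 ^ (d - 1)) → M.Pairs → Fin 2,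
        𝔼 L : PerfectMatching (n - d + 1), 𝔼 ν : Fin (2 ^ (d - 1)) → L.Pairs → Fin 2,
          (2 ^ n * ∑ x, mixturePmf hd hdn L ν δ x * mixturePmf hd hdn M μ δ x) ^ m := by
  rw [sum_averagePmf_mul]
  simp only [mul_comm _ (averagePmf hd hdn δ m _), sum_averagePmf_mul, sum_prod_mul_prod,
    mul_expect, ← mul_pow]

end MixtureOfTrees

open MixtureOfTrees

/-! ### The lower bound -/

theorem lemma4p3 :
    ∃ (c C : ℝ) (d₀ : ℕ), 0 < c ∧ 0 < C ∧
      ∀ (n d : ℕ) (hd : 1 ≤ d) (hdn : d ≤ n), Even (n - d + 1) →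
        d₀ ≤ d → (d : ℝ) ≤ c * Real.log n →
        ∀ ε : ℝ, 0 < ε → ε ≤ 1 →
        ∀ (m : ℕ) (T : MixtureOfTrees.Test n m),
          MixtureOfTrees.Distinguishes hd hdn (ε / Real.sqrt n) T →
          C * ((2 : ℝ) ^ ((d : ℝ) / 2) * n / ε ^ 2) ≤ m := by
  -- With `c = 1/3` and `d ≥ 1`, `log n ≥ 3` and so `n ≥ 16`, which ensures `4δ ≤ 1` and hence
  -- nonnegative densities. The square of `C` is the constant in the bound on `m²`.
  refine ⟨1 / 3, 1 / (512 * Real.exp 8), 0, by norm_num, by positivity, ?_⟩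
  intro n d hd hdn _ _ hlog ε h0 h1 m T hT
  have hn : 16 ≤ n := by
    have hd' : (1 : ℝ) ≤ d := by exact_mod_cast hd
    have hn0 : (0 : ℝ) < n := by exact_mod_cast lt_of_lt_of_le hd hdn
    have hlog3 : (3 : ℝ) ≤ Real.log n := by linarith
    have hexp : Real.exp 3 ≤ n := (Real.le_log_iff_exp_le hn0).1 hlog3
    have h16 : (16 : ℝ) ≤ Real.exp 3 := by
      have h3 : Real.exp 3 = Real.exp 1 ^ 3 := by rw [← Real.exp_nat_mul]; norm_num
      rw [h3]
      have := pow_le_pow_left₀ (by norm_num) Real.exp_one_gt_d9.le 3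
      norm_num at this ⊢
      linarith
    exact_mod_cast h16.trans hexp
  by_contra! hm
  have hmsq : (m : ℝ) ^ 2 ≤ 2 ^ d * n ^ 2 / ε ^ 4 / (512 ^ 2 * Real.exp 16) := by
    refine (pow_le_pow_left₀ (Nat.cast_nonneg m) hm.le 2).trans_eq ?_
    have hpow : ((2 : ℝ) ^ ((d : ℝ) / 2)) ^ 2 = 2 ^ d := by
      rw [← Real.rpow_mul_natCast (by norm_num), ← Real.rpow_natCast]
      congr 1
      push_cast
      ring
    have hexp : Real.exp 16 = Real.exp 8 ^ 2 := by rw [← Real.exp_nat_mul]; norm_num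
    rw [mul_pow, div_pow _ (ε ^ 2), mul_pow _ (n : ℝ), hpow, hexp]
    field_simp
  have hA : 2 / 3 ≤ ∑ x, averagePmf hd hdn (ε / √n) m x * (1 - (T x : ℝ)) := by
    rw [sum_averagePmf_mul]
    exact hT.2
  have hge := four_thirds_le_second_moment T _ hT.1 hA
  rw [second_moment_averagePmf] at hge
  refine absurd (hge.trans ?_) (by norm_num : ¬(4 / 3 : ℝ) ≤ 5 / 4)
  rcases isEmpty_or_nonempty (PerfectMatching (n - d + 1)) with hempty | hne
  -- An average over an empty type is 0.
  · rw [univ_eq_empty, expect_empty]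
    norm_num
  · exact expect_le univ_nonempty fun M _ => expect_le univ_nonempty fun μ _ =>
      expect_correlation_pow_le hd hdn M μ h0 h1 hn m hmsq
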